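/- All vector spaces are over $\mathbb C$. A \emph{Lie conformal algebra} is a $\mathbb C[\partial]$-module $R$ with a $\mathbb C$-bilinear $\lambda$-bracket $R\times R\to R[\lambda]$, $(a,b)\mapsto[a_\lambda b]$, satisfying $[\partial a_\lambda b]=-\lambda[a_\lambda b]$, $[a_\lambda\partial b]=(\partial+\lambda)[a_\lambda b]$, $[a_\lambda b]=-[b_{-\lambda-\partial}a]$ and $[a_\lambda[b_\mu c]]=[[a_\lambda b]_{\lambda+\mu}c]+[b_\mu[a_\lambda c]]$. A \emph{conformal module} over $R$ is a $\mathbb C[\partial]$-module $V$ with a $\mathbb C$-bilinear map $R\times V\to V[\lambda]$, $(a,v)\mapsto a_\lambda v$, such that $a_\lambda(b_\mu v)-b_\mu(a_\lambda v)=[a_\lambda b]_{\lambda+\mu}v$ and $(\partial a)_\lambda v=\partial(a_\lambda v)-a_\lambda(\partial v)=-\lambda a_\lambda v$. It is \emph{finite} if it is finitely generated over $\mathbb C[\partial]$, \emph{trivial} if $a_\lambda v=0$ for all $a\in R$, $v\in V$, and \emph{irreducible} if $V\neq0$ and the only $\mathbb C[\partial]$-submodules $U\subseteq V$ with $a_\lambda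 U\subseteq U[\lambda]$ for all $a\in R$ are $0$ and $V$. An isomorphism of conformal modules is a $\mathbb C[\partial]$-linear bijection that commutes with all $a_\lambda$. The \emph{extended Schrödinger--Virasoro conformal algebra} is the free $\mathbb C[\partial]$-module $$\widetilde{\mathrm{SV}}=\mathbb C[\partial]L\oplus\mathbb C[\partial]M\oplus\mathbb C[\partial]Y\oplus\mathbb C[\partial]N$$ whose $\lambda$-bracket is determined by sesquilinearity, skew-symmetry and $$[L_\lambda L]=(\partial+2\lambda)L,\quad [L_\lambda Y]=(\partial+\tfrac32\lambda)Y,\quad [L_\lambda M]=(\partial+\lambda)M,\quad [Y_\lambda Y]=(\partial+2\lambda)M,$$ $$[L_\lambda N]=(\partial+\lambda)N,\quad [N_\lambda M]=2M,\quad [N_\lambda Y]=Y,$$ with $[M_\lambda M]=[M_\lambda Y]=[N_\lambda N]=0$. For $\alpha,\beta,\Delta\in\mathbb C$ let $V(\alpha,\beta,\Delta)=\mathbb C[\partial]v$ be the conformal $\widetilde{\mathrm{SV}}$-module that is free of rank one over $\mathbb C[\partial]$ with $$L_\lambda v=(\partial+\alpha+\Delta\lambda)v,\qquad N_\lambda v=\beta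 v,\qquad M_\lambda v=Y_\lambda v=0.$$ \textbf{Theorem.} Let $V$ be a finite nontrivial irreducible conformal module over $\widetilde{\mathrm{SV}}$. Then there are $\alpha,\beta,\Delta\in\mathbb C$ with $(\Delta,\beta)\neq(0,0)$ such that $V\cong V(\alpha,\beta,\Delta)$. -/

import Mathlib

open Polynomial

set_option linter.unusedSectionVars false

noncomputable section

namespace Conformal

/-! A `ℂ[∂]`-module is a `ℂ[X]`-module, `X` acting as `∂`. For such a module `V`, the space
`V[λ] = ℂ[λ] ⊗ V` is `ℕ →₀ V`: the family `c` stands for `∑ n, λ ^ n c n`, and `ℂ[∂]` acts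
coefficientwise. -/

section Lambda

variable {V : Type*} [AddCommGroup V] [Module ℂ V] [Module ℂ[X] V] [IsScalarTower ℂ ℂ[X] V]

/-- Substitution of `s(∂) ∈ ℂ[∂]` for `λ`: it sends `∑ λ ^ n c n` to `∑ s(∂) ^ n c n`. -/
def subst (s : ℂ[X]) : (ℕ →₀ V) →ₗ[ℂ[X]] V :=
  Finsupp.lsum ℂ[X] fun n => s ^ n • LinearMap.id

/-- The value of a polynomial in `V[λ]` at the complex number `z`. -/
def evalAt (z : ℂ) : (ℕ →₀ V) →ₗ[ℂ[X]] V := subst (C z)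

/-- Multiplication by `λ` on `V[λ]`. -/
def mulLam : Module.End ℂ (ℕ →₀ V) := Finsupp.lmapDomain V ℂ Nat.succ

/-- Multiplication by `∂` on `V[λ]`. -/
def mulD : Module.End ℂ (ℕ →₀ V) := Algebra.lsmul ℂ ℂ (ℕ →₀ V) (X : ℂ[X])

/-- The operator `p(-λ) q(∂ + λ)` on `V[λ]`, applied to `w`, as a bilinear function of `p, q`. -/
def sesq (w : ℕ →₀ V) : ℂ[X] →ₗ[ℂ] ℂ[X] →ₗ[ℂ] (ℕ →₀ V) :=
  LinearMap.mk₂ ℂ (fun p q => aeval (-mulLam : Module.End ℂ (ℕ →₀ V)) p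
      (aeval (mulD + mulLam : Module.End ℂ (ℕ →₀ V)) q w))
    (by intros; simp) (by intros; simp) (by intros; simp) (by intros; simp)

lemma subst_single (s : ℂ[X]) (n : ℕ) (v : V) : subst s (Finsupp.single n v) = s ^ n • v := by
  simp [subst]

lemma subst_mulLam (s : ℂ[X]) (w : ℕ →₀ V) : subst s (mulLam w) = s • subst s w := by
  induction w using Finsupp.induction_linear with
  | zero => simp
  | add f g hf hg => simp [hf, hg]
  | single n v =>
    simp [mulLam, Finsupp.mapDomain_single, subst_single, pow_succ', mul_smul]

lemma subst_mulD (s : ℂ[X]) (w : ℕ →₀ V) : subst s (mulD w) = (X : ℂ[X]) • subst s w := by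
  simp [mulD]

lemma subst_aeval (s t : ℂ[X]) (T : Module.End ℂ (ℕ →₀ V))
    (hT : ∀ w, subst s (T w) = t • subst s w) (p : ℂ[X]) (w : ℕ →₀ V) :
    subst s (aeval T p w) = p.comp t • subst s w := by
  induction p using Polynomial.induction_on' with
  | add p q hp hq => simp [hp, hq, add_smul]
  | monomial n c =>
    have h : ∀ n : ℕ, subst s ((T ^ n) w) = t ^ n • subst s w := by
      intro n
      induction n with
      | zero => simp
      | succ n ih => rw [pow_succ', Module.End.mul_apply, hT, ih, pow_succ', mul_smul]
    have hc : ∀ (c : ℂ) (v : ℕ →₀ V), subst s (c • v) = c • subst s v := by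
      intro c v
      rw [← algebraMap_smul ℂ[X] c v, map_smul, algebraMap_smul]
    rw [aeval_monomial, Module.End.mul_apply, Module.algebraMap_end_apply, hc, h,
      monomial_comp, mul_smul, ← Polynomial.algebraMap_eq, algebraMap_smul]

lemma subst_sesq (s : ℂ[X]) (w : ℕ →₀ V) (p q : ℂ[X]) :
    subst s (sesq w p q) = p.comp (-s) • q.comp (X + s) • subst s w := by
  have h1 : ∀ w : ℕ →₀ V, subst s ((-mulLam : Module.End ℂ (ℕ →₀ V)) w) = (-s) • subst s w := by
    intro w
    simp [subst_mulLam]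
  have h2 : ∀ w : ℕ →₀ V,
      subst s ((mulD + mulLam : Module.End ℂ (ℕ →₀ V)) w) = (X + s) • subst s w := by
    intro w
    simp [subst_mulLam, subst_mulD, add_smul]
  simp only [sesq, LinearMap.mk₂_apply]
  rw [subst_aeval _ _ _ h1, subst_aeval _ _ _ h2]

end Lambda

/-- A Lie conformal algebra structure on a `ℂ[∂]`-module `R`. Identities between polynomials in
`λ` (and `μ`) are stated for all complex values `x` of `λ` (and `y` of `μ`), which is the same
because `ℂ` is infinite. -/
structure LieConformalAlgebra (R : Type*) [AddCommGroup R] [Module ℂ R] [Module ℂ[X] R]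
    [IsScalarTower ℂ ℂ[X] R] where
  /-- The `λ`-bracket `[a_λ b]`. -/
  bracket : R →ₗ[ℂ] R →ₗ[ℂ] (ℕ →₀ R)
  bracket_D_left : ∀ (a b : R) (x : ℂ),
    evalAt x (bracket ((X : ℂ[X]) • a) b) = -(x • evalAt x (bracket a b))
  bracket_D_right : ∀ (a b : R) (x : ℂ),
    evalAt x (bracket a ((X : ℂ[X]) • b)) = (X + C x : ℂ[X]) • evalAt x (bracket a b)
  skew : ∀ (a b : R) (x : ℂ),
    evalAt x (bracket a b) = -subst (-C x - X) (bracket b a)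
  jacobi : ∀ (a b c : R) (x y : ℂ),
    evalAt x (bracket a (evalAt y (bracket b c))) =
      evalAt (x + y) (bracket (evalAt x (bracket a b)) c) +
        evalAt y (bracket b (evalAt x (bracket a c)))

/-- A conformal module structure over the Lie conformal algebra `A` on a `ℂ[∂]`-module `V`. -/
structure ConformalModule {R : Type*} [AddCommGroup R] [Module ℂ R] [Module ℂ[X] R]
    [IsScalarTower ℂ ℂ[X] R] (A : LieConformalAlgebra R)
    (V : Type*) [AddCommGroup V] [Module ℂ V] [Module ℂ[X] V] [IsScalarTower ℂ ℂ[X] V] where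
  /-- The `λ`-action `a_λ v`. -/
  act : R →ₗ[ℂ] V →ₗ[ℂ] (ℕ →₀ V)
  act_D_left : ∀ (a : R) (v : V) (x : ℂ),
    evalAt x (act ((X : ℂ[X]) • a) v) = -(x • evalAt x (act a v))
  D_comm : ∀ (a : R) (v : V) (x : ℂ),
    (X : ℂ[X]) • evalAt x (act a v) - evalAt x (act a ((X : ℂ[X]) • v)) =
      -(x • evalAt x (act a v))
  jacobi : ∀ (a b : R) (v : V) (x y : ℂ),
    evalAt x (act a (evalAt y (act b v))) - evalAt y (act b (evalAt x (act a v))) =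
      evalAt (x + y) (act (evalAt x (A.bracket a b)) v)

namespace ConformalModule

variable {R : Type*} [AddCommGroup R] [Module ℂ R] [Module ℂ[X] R] [IsScalarTower ℂ ℂ[X] R]
  {A : LieConformalAlgebra R}
  {V : Type*} [AddCommGroup V] [Module ℂ V] [Module ℂ[X] V] [IsScalarTower ℂ ℂ[X] V]
  {W : Type*} [AddCommGroup W] [Module ℂ W] [Module ℂ[X] W] [IsScalarTower ℂ ℂ[X] W]

/-- Every element of the algebra acts by zero. -/
def IsTrivial (ρ : ConformalModule A V) : Prop := ∀ (a : R) (v : V), ρ.act a v = 0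

/-- A `ℂ[∂]`-submodule `U` with `a_λ U ⊆ U[λ]` for all `a`. -/
def IsInvariant (ρ : ConformalModule A V) (U : Submodule ℂ[X] V) : Prop :=
  ∀ (a : R), ∀ v ∈ U, ∀ n : ℕ, ρ.act a v n ∈ U

/-- The module is nonzero, and its only conformal submodules are zero and the whole module. -/
def IsIrreducible (ρ : ConformalModule A V) : Prop :=
  Nontrivial V ∧ ∀ U : Submodule ℂ[X] V, ρ.IsInvariant U → U = ⊥ ∨ U = ⊤

/-- Isomorphism of conformal modules. -/
def Iso (ρ : ConformalModule A V) (σ : ConformalModule A W) : Prop :=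
  ∃ φ : V ≃ₗ[ℂ[X]] W, ∀ (a : R) (v : V) (n : ℕ), σ.act a (φ v) n = φ (ρ.act a v n)

end ConformalModule

/-- The generators of the extended Schrödinger–Virasoro conformal algebra. -/
inductive Gen
  | L | M | Y | N
  deriving DecidableEq

instance : Fintype Gen where
  elems := {.L, .M, .Y, .N}
  complete := by rintro (_ | _ | _ | _) <;> simp

/-- The free `ℂ[∂]`-module on `L, M, Y, N`. -/
abbrev SV : Type := Gen → ℂ[X]

/-- The element `p(∂) g + λ q(∂) g` of `SV[λ]`. -/
def lin (g : Gen) (p q : ℂ[X]) : ℕ →₀ SV :=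
  Finsupp.single 0 (Pi.single g p) + Finsupp.single 1 (Pi.single g q)

/-- The `λ`-brackets of the generators. -/
def genBracket : Gen → Gen → (ℕ →₀ SV)
  | .L, .L => lin .L X (C 2)
  | .L, .Y => lin .Y X (C (3 / 2))
  | .L, .M => lin .M X (C 1)
  | .Y, .Y => lin .M X (C 2)
  | .L, .N => lin .N X (C 1)
  | .N, .M => lin .M (C 2) 0
  | .N, .Y => lin .Y (C 1) 0
  -- obtained from the ones above by skew-symmetry
  | .Y, .L => lin .Y (C (1 / 2) * X) (C (3 / 2))
  | .M, .L => lin .M 0 (C 1)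
  | .N, .L => lin .N 0 (C 1)
  | .M, .N => lin .M (C (-2)) 0
  | .Y, .N => lin .Y (C (-1)) 0
  -- all others vanish
  | .M, .M => 0
  | .M, .Y => 0
  | .Y, .M => 0
  | .N, .N => 0

/-- The sesquilinear extension `[p(∂) g_λ q(∂) h] = p(-λ) q(∂ + λ) [g_λ h]`. -/
def svBracket : SV →ₗ[ℂ] SV →ₗ[ℂ] (ℕ →₀ SV) :=
  ∑ g : Gen, ∑ h : Gen,
    (sesq (genBracket g h)).compl₁₂ (LinearMap.proj g) (LinearMap.proj h)

lemma gen_sum {M : Type*} [AddCommMonoid M] (f : Gen → M) :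
    ∑ g, f g = f .L + (f .M + (f .Y + f .N)) := by
  have : (Finset.univ : Finset Gen) = {.L, .M, .Y, .N} := rfl
  rw [this]
  simp

lemma subst_svBracket (s : ℂ[X]) (a b : SV) :
    subst s (svBracket a b) =
      ∑ g, ∑ h, (a g).comp (-s) • (b h).comp (X + s) • subst s (genBracket g h) := by
  simp [svBracket, subst_sesq]

lemma subst_lin (s : ℂ[X]) (g : Gen) (p q : ℂ[X]) :
    subst s (lin g p q) = Pi.single g (p + s * q) := by
  simp [lin, subst_single, Pi.single_add]
  ext1 h
  by_cases hh : h = g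
  · subst hh; simp
  · simp [hh]

lemma subst_svBracket_L (s : ℂ[X]) (a b : SV) : subst s (svBracket a b) .L =
    (a .L).comp (-s) * (b .L).comp (X + s) * (X + C 2 * s) := by
  simp only [subst_svBracket, gen_sum, genBracket, subst_lin, map_zero]
  simp
  ring

lemma subst_svBracket_M (s : ℂ[X]) (a b : SV) : subst s (svBracket a b) .M =
    (a .L).comp (-s) * (b .M).comp (X + s) * (X + s) +
      (a .M).comp (-s) * (b .L).comp (X + s) * s +
      (a .Y).comp (-s) * (b .Y).comp (X + s) * (X + C 2 * s) +
      (a .N).comp (-s) * (b .M).comp (X + s) * C 2 -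
      (a .M).comp (-s) * (b .N).comp (X + s) * C 2 := by
  simp only [subst_svBracket, gen_sum, genBracket, subst_lin, map_zero]
  simp
  ring

lemma subst_svBracket_Y (s : ℂ[X]) (a b : SV) : subst s (svBracket a b) .Y =
    (a .L).comp (-s) * (b .Y).comp (X + s) * (X + C (3 / 2) * s) +
      (a .Y).comp (-s) * (b .L).comp (X + s) * (C (1 / 2) * X + C (3 / 2) * s) +
      (a .N).comp (-s) * (b .Y).comp (X + s) -
      (a .Y).comp (-s) * (b .N).comp (X + s) := by
  simp only [subst_svBracket, gen_sum, genBracket, subst_lin, map_zero]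
  simp
  ring

lemma subst_svBracket_N (s : ℂ[X]) (a b : SV) : subst s (svBracket a b) .N =
    (a .L).comp (-s) * (b .N).comp (X + s) * (X + s) +
      (a .N).comp (-s) * (b .L).comp (X + s) * s := by
  simp only [subst_svBracket, gen_sum, genBracket, subst_lin, map_zero]
  simp
  ring

lemma comp_neg_C (p q : ℂ[X]) (x : ℂ) : (p.comp (-C x)).comp q = p.comp (-C x) := by
  simp [comp_assoc]

lemma comp_X_add_C (p : ℂ[X]) (x y : ℂ) :
    (p.comp (X + C y)).comp (X + C x) = p.comp (X + C (x + y)) := by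
  simp [comp_assoc, add_assoc]

lemma comp_X_add_C_neg (p : ℂ[X]) (x y : ℂ) :
    (p.comp (X + C x)).comp (-C (x + y)) = p.comp (-C y) := by
  simp [comp_assoc]

/-- The extended Schrödinger–Virasoro conformal algebra. -/
def svTilde : LieConformalAlgebra SV where
  bracket := svBracket
  bracket_D_left := by
    intro a b x
    simp only [evalAt]
    ext1 k
    cases k <;>
      simp only [Pi.neg_apply, Pi.smul_apply, subst_svBracket_L, subst_svBracket_M,
        subst_svBracket_Y, subst_svBracket_N, smul_eq_C_mul, smul_eq_mul, mul_comp, X_comp] <;>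
      ring
  bracket_D_right := by
    intro a b x
    simp only [evalAt]
    ext1 k
    cases k <;>
      simp only [Pi.smul_apply, subst_svBracket_L, subst_svBracket_M,
        subst_svBracket_Y, subst_svBracket_N, smul_eq_mul, mul_comp, X_comp] <;>
      ring
  skew := by
    intro a b x
    have h1 : -(-C x - X) = (X + C x : ℂ[X]) := by ring
    have h2 : X + (-C x - X) = (-C x : ℂ[X]) := by ring
    simp only [evalAt]
    ext1 k
    cases k <;>
      simp only [Pi.neg_apply, subst_svBracket_L, subst_svBracket_M, subst_svBracket_Y,
        subst_svBracket_N, h1, h2] <;>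
      refine Polynomial.funext fun z => ?_ <;>
      simp only [eval_add, eval_sub, eval_neg, eval_mul, eval_comp, eval_X, eval_C] <;>
      ring
  jacobi := by
    intro a b c x y
    simp only [evalAt]
    ext1 k
    cases k <;>
      simp only [Pi.add_apply, subst_svBracket_L, subst_svBracket_M, subst_svBracket_Y,
        subst_svBracket_N, mul_comp, add_comp, sub_comp, X_comp, C_comp, comp_neg_C,
        comp_X_add_C, comp_X_add_C_neg, add_comm y x] <;>
      refine Polynomial.funext fun z => ?_ <;>
      simp only [eval_add, eval_sub, eval_neg, eval_mul, eval_comp, eval_X, eval_C] <;>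
      ring

/-- The `λ`-actions of the generators on the generator `1` of `ℂ[∂]`. -/
def genAct (α β Δ : ℂ) : Gen → (ℕ →₀ ℂ[X])
  | .L => Finsupp.single 0 (X + C α) + Finsupp.single 1 (C Δ)
  | .N => Finsupp.single 0 (C β)
  | .M => 0
  | .Y => 0

/-- The sesquilinear extension `(p(∂) g)_λ (q(∂) v) = p(-λ) q(∂ + λ) (g_λ v)`, where `v = 1`. -/
def rankOneAct (α β Δ : ℂ) : SV →ₗ[ℂ] ℂ[X] →ₗ[ℂ] (ℕ →₀ ℂ[X]) :=
  ∑ g : Gen, (sesq (genAct α β Δ g)).comp (LinearMap.proj g)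

lemma subst_rankOneAct (α β Δ : ℂ) (s : ℂ[X]) (a : SV) (q : ℂ[X]) :
    subst s (rankOneAct α β Δ a q) =
      ∑ g, (a g).comp (-s) • q.comp (X + s) • subst s (genAct α β Δ g) := by
  simp [rankOneAct, subst_sesq]

lemma subst_rankOneAct_eq (α β Δ : ℂ) (s : ℂ[X]) (a : SV) (q : ℂ[X]) :
    subst s (rankOneAct α β Δ a q) =
      (a .L).comp (-s) * q.comp (X + s) * (X + C α + C Δ * s) +
        (a .N).comp (-s) * q.comp (X + s) * C β := by
  simp only [subst_rankOneAct, gen_sum, genAct, map_add, map_zero, subst_single]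
  simp
  ring

/-- The module `V(α, β, Δ) = ℂ[∂] v` of rank one. -/
def rankOne (α β Δ : ℂ) : ConformalModule svTilde ℂ[X] where
  act := rankOneAct α β Δ
  act_D_left := by
    intro a v x
    simp only [evalAt, subst_rankOneAct_eq, Pi.smul_apply, smul_eq_mul, smul_eq_C_mul, mul_comp,
      X_comp]
    ring
  D_comm := by
    intro a v x
    simp only [evalAt, subst_rankOneAct_eq, smul_eq_mul, smul_eq_C_mul, mul_comp, X_comp]
    ring
  jacobi := by
    intro a b v x y
    simp only [svTilde, evalAt, subst_rankOneAct_eq, subst_svBracket_L, subst_svBracket_N,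
      mul_comp, add_comp, X_comp, C_comp, comp_neg_C, comp_X_add_C, comp_X_add_C_neg,
      add_comm y x]
    refine Polynomial.funext fun z => ?_
    simp only [eval_add, eval_sub, eval_neg, eval_mul, eval_comp, eval_X, eval_C]
    ring

end Conformal

end

namespace Conformal

/-! ### Polynomials in `λ` with coefficients in a module -/

section Lambda

variable {V : Type*} [AddCommGroup V] [Module ℂ V] [Module ℂ[X] V] [IsScalarTower ℂ ℂ[X] V]

/-! Write `a_n` for the coefficient of `λ ^ n` in `a_λ`, without divided powers. A vector killed by
`∂ - c` is killed by the whole algebra, so irreducibility and nontriviality make `V` torsion-free,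
hence free of finite rank. Both `L_0` and `∂` induce `a ↦ ∂a` on the algebra, so `L_0 - ∂` commutes
with the action, and Schur's lemma gives `L_0 = ∂ + α`.

Since `L_λ` is now injective and `∂` raises the `λ`-degree of `L_λ v`, the vectors with `L_k v = N_k
v = 0` for all `k ≥ m` form a finite-dimensional space. This supplies eigenvectors twice.

`N_0` has an eigenvector there, with eigenvalue `β`. The generators raise `N_0`-eigenvalues by 0, 1
or 2, so the eigenspaces for `β + 1, β + 2, ...` span a proper submodule, which is zero. Hence `M`
and `Y` kill the `β`-eigenspace, which is then invariant and equal to `V`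
(`coef_N_zero_and_charged`).

For `m > 0`, `L_1` also acts there, and `L_{n+2}`, `N_{n+1}` lower its eigenvalues by `n + 1`. An
eigenvector `w` whose eigenvalue `Δ` has least real part is thus killed by them
(`exists_highest_weight_vector`). Now `ℂ[∂]w` is invariant, so it is `V`. If `Δ = β = 0`, then `(∂ +
α)w` would generate a proper nonzero submodule. -/

lemma C_smul_eq (c : ℂ) (v : V) : (C c : ℂ[X]) • v = c • v := by
  rw [← Polynomial.algebraMap_eq, algebraMap_smul]

lemma evalAt_single (x : ℂ) (n : ℕ) (v : V) :
    evalAt x (Finsupp.single n v) = x ^ n • v := by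
  rw [evalAt, subst_single, ← C_pow, C_smul_eq]

/-- The polynomial `∑ λ ^ n f(c n)` obtained by applying a functional to `∑ λ ^ n c n`. -/
noncomputable def dualPoly (f : V →ₗ[ℂ] ℂ) : (ℕ →₀ V) →ₗ[ℂ] ℂ[X] :=
  Finsupp.lsum ℂ fun n => (monomial n : ℂ →ₗ[ℂ] ℂ[X]) ∘ₗ f

lemma coeff_dualPoly (f : V →ₗ[ℂ] ℂ) (w : ℕ →₀ V) (n : ℕ) :
    (dualPoly f w).coeff n = f (w n) := by
  induction w using Finsupp.induction_linear with
  | zero => simp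
  | add p q hp hq => simp [hp, hq]
  | single m v =>
    simp only [dualPoly, Finsupp.lsum_single, LinearMap.comp_apply, coeff_monomial,
      Finsupp.single_apply]
    split_ifs <;> simp

lemma eval_dualPoly (f : V →ₗ[ℂ] ℂ) (w : ℕ →₀ V) (x : ℂ) :
    (dualPoly f w).eval x = f (evalAt x w) := by
  induction w using Finsupp.induction_linear with
  | zero => simp
  | add p q hp hq => simp [hp, hq]
  | single m v => simp [dualPoly, evalAt_single, mul_comm]

lemma eq_of_dual_eq {v w : V} (h : ∀ f : V →ₗ[ℂ] ℂ, f v = f w) : v = w := by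
  rw [← sub_eq_zero, ← Module.forall_dual_apply_eq_zero_iff ℂ]
  intro f
  rw [map_sub, h f, sub_self]

/-- Linear functionals separate points of `V` and reduce the claim to scalar polynomials over the
infinite field `ℂ`. This turns pointwise identities in `λ` into identities of coefficients. -/
lemma eq_of_evalAt_eq {v w : ℕ →₀ V} (h : ∀ x, evalAt x v = evalAt x w) : v = w := by
  ext n
  refine eq_of_dual_eq fun f => ?_
  have : dualPoly f v = dualPoly f w := Polynomial.funext fun x => by
    rw [eval_dualPoly, eval_dualPoly, h]
  rw [← coeff_dualPoly, this, coeff_dualPoly]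

lemma evalAt_zero_eq (w : ℕ →₀ V) : evalAt 0 w = w 0 :=
  eq_of_dual_eq fun f => by
    rw [← eval_dualPoly, ← coeff_zero_eq_eval_zero, coeff_dualPoly]

lemma evalAt_smul (x c : ℂ) (w : ℕ →₀ V) : evalAt x (c • w) = c • evalAt x w := by
  rw [← C_smul_eq c w, map_smul, C_smul_eq]

lemma evalAt_mulLam (x : ℂ) (w : ℕ →₀ V) : evalAt x (mulLam w) = x • evalAt x w := by
  rw [evalAt, subst_mulLam, C_smul_eq]

lemma mulLam_zero (w : ℕ →₀ V) : mulLam w 0 = 0 :=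
  Finsupp.mapDomain_of_notMem_range _ _ (by simp)

lemma mulLam_succ (w : ℕ →₀ V) (n : ℕ) : mulLam w (n + 1) = w n :=
  Finsupp.mapDomain_apply Nat.succ_injective w n

end Lambda

/-! ### Coefficients of the action and degree in `λ` -/

namespace ConformalModule

variable {R : Type*} [AddCommGroup R] [Module ℂ R] [Module ℂ[X] R] [IsScalarTower ℂ ℂ[X] R]
  {A : LieConformalAlgebra R}
  {V : Type*} [AddCommGroup V] [Module ℂ V] [Module ℂ[X] V] [IsScalarTower ℂ ℂ[X] V]
  (ρ : ConformalModule A V)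

/-- The coefficient of `λ ^ n` in `a_λ`. -/
noncomputable def coef (a : R) (n : ℕ) : V →ₗ[ℂ] V := Finsupp.lapply n ∘ₗ ρ.act a

lemma coef_apply (a : R) (n : ℕ) (v : V) : ρ.coef a n v = ρ.act a v n := rfl

lemma act_X_smul (a : R) (v : V) :
    ρ.act a ((X : ℂ[X]) • v) = (X : ℂ[X]) • ρ.act a v + mulLam (ρ.act a v) :=
  eq_of_evalAt_eq fun x => by
    have h := ρ.D_comm a v x
    rw [sub_eq_iff_eq_add] at h
    rw [map_add, (evalAt x).map_smul, evalAt_mulLam, h]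
    abel

lemma act_X_smul_left (a : R) (v : V) :
    ρ.act ((X : ℂ[X]) • a) v = -mulLam (ρ.act a v) :=
  eq_of_evalAt_eq fun x => by rw [map_neg, evalAt_mulLam, ρ.act_D_left]

lemma coef_zero_X_smul (a : R) (v : V) :
    ρ.coef a 0 ((X : ℂ[X]) • v) = (X : ℂ[X]) • ρ.coef a 0 v := by
  simp [coef_apply, act_X_smul, mulLam_zero]

lemma coef_succ_X_smul (a : R) (n : ℕ) (v : V) :
    ρ.coef a (n + 1) ((X : ℂ[X]) • v) = (X : ℂ[X]) • ρ.coef a (n + 1) v + ρ.coef a n v := by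
  simp [coef_apply, act_X_smul, mulLam_succ]

lemma coef_X_smul_left_zero (a : R) (v : V) : ρ.coef ((X : ℂ[X]) • a) 0 v = 0 := by
  simp [coef_apply, act_X_smul_left, mulLam_zero]

lemma coef_X_smul_left_succ (a : R) (n : ℕ) (v : V) :
    ρ.coef ((X : ℂ[X]) • a) (n + 1) v = -ρ.coef a n v := by
  simp [coef_apply, act_X_smul_left, mulLam_succ]

lemma coef_add_left (a b : R) (n : ℕ) (v : V) :
    ρ.coef (a + b) n v = ρ.coef a n v + ρ.coef b n v := by
  simp [coef_apply]

lemma coef_smul_left (c : ℂ) (a : R) (n : ℕ) (v : V) :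
    ρ.coef (c • a) n v = c • ρ.coef a n v := by
  simp [coef_apply]

lemma exists_coef_eq_zero (a : R) (v : V) : ∃ m, ∀ k, m ≤ k → ρ.coef a k v = 0 := by
  refine ⟨(ρ.act a v).support.sup id + 1, fun k hk => ?_⟩
  by_contra h
  have := Finset.le_sup (f := id) (Finsupp.mem_support_iff.mpr h)
  simp only [id] at this
  omega

/-- A family of coefficients in which each one is determined by the next is zero. -/
lemma coef_eq_zero_of_step (a : R) (v : V) (m : ℕ)
    (h : ∀ k, m ≤ k → ρ.coef a (k + 1) v = 0 → ρ.coef a k v = 0) :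
    ∀ k, m ≤ k → ρ.coef a k v = 0 := by
  obtain ⟨M, hM⟩ := ρ.exists_coef_eq_zero a v
  have key : ∀ d k, m ≤ k → M ≤ k + d → ρ.coef a k v = 0 := by
    intro d
    induction d with
    | zero => exact fun k _ hk => hM k hk
    | succ d ih => exact fun k hmk hk => h k hmk (ih (k + 1) (by omega) (by omega))
  exact fun k hk => key M k hk (by omega)

/-- Since `a_λ(∂v) = (∂ + λ) a_λ v`, applying `∂` to `v` raises the `λ`-degree by exactly one unless
`a_λ v = 0`. -/
lemma coef_eq_zero_of_X_smul (a : R) (v : V) (m : ℕ)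
    (h : ∀ k, m + 1 ≤ k → ρ.coef a k ((X : ℂ[X]) • v) = 0) :
    ∀ k, m ≤ k → ρ.coef a k v = 0 := by
  refine ρ.coef_eq_zero_of_step a v m fun k hk h0 => ?_
  have := h (k + 1) (by omega)
  rwa [coef_succ_X_smul, h0, smul_zero, zero_add] at this

lemma coef_eq_zero_of_X_pow_smul (a : R) (v : V) (m : ℕ)
    (h : ∀ k, m ≤ k → ρ.coef a k ((X : ℂ[X]) ^ m • v) = 0) :
    ∀ k, ρ.coef a k v = 0 := by
  induction m generalizing v with
  | zero => simpa using h
  | succ m ih =>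
    refine ih v (ρ.coef_eq_zero_of_X_smul a _ m ?_)
    simpa [pow_succ', mul_smul] using h

/-- Here `(∂ + λ - c) a_λ v = 0`, and the factor is monic in `λ`. -/
lemma coef_eq_zero_of_X_smul_eq (a : R) (v : V) (c : ℂ) (h : (X : ℂ[X]) • v = c • v) (k : ℕ) :
    ρ.coef a k v = 0 := by
  refine ρ.coef_eq_zero_of_step a v 0 (fun k _ h0 => ?_) k (Nat.zero_le k)
  have := ρ.coef_succ_X_smul a k v
  rwa [h, map_smul, h0, smul_zero, smul_zero, zero_add, eq_comm] at this

/-! ### Torsion-freeness -/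

variable {ρ}

/-- A nontrivial irreducible conformal module is torsion-free over `ℂ[∂]`. -/
theorem IsIrreducible.isTorsionFree (hirr : ρ.IsIrreducible) (hnt : ¬ ρ.IsTrivial) :
    Module.IsTorsionFree ℂ[X] V := by
  -- The algebra kills the kernel of `∂ - c`, which is therefore invariant; if it were all of `V`,
  -- the module would be trivial. General torsion reduces to this case by splitting the polynomial
  -- into linear factors.
  have hroot : ∀ (c : ℂ) (v : V), (X - C c : ℂ[X]) • v = 0 → v = 0 := by
    intro c
    let U : Submodule ℂ[X] V := LinearMap.ker (LinearMap.lsmul ℂ[X] V (X - C c))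
    have hmem : ∀ v, v ∈ U ↔ (X : ℂ[X]) • v = c • v := by
      intro v
      simp [U, C_smul_eq, sub_eq_zero]
    have hU : ρ.IsInvariant U := by
      intro a v hv n
      rw [← coef_apply, ρ.coef_eq_zero_of_X_smul_eq a v c ((hmem v).mp hv)]
      exact U.zero_mem
    rcases hirr.2 U hU with h | h
    · intro v hv
      have : v ∈ U := hv
      rwa [h, Submodule.mem_bot] at this
    · refine absurd (fun a v => ?_) hnt
      ext n
      exact ρ.coef_eq_zero_of_X_smul_eq a v c ((hmem v).mp (h ▸ Submodule.mem_top)) n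
  rw [Module.isTorsionFree_iff_smul_eq_zero]
  intro p v hp
  by_contra! hne
  obtain ⟨hp0, hv⟩ := hne
  have key : ∀ s : Multiset ℂ, ((s.map fun c => (X - C c : ℂ[X])).prod) • v ≠ 0 := by
    intro s
    induction s using Multiset.induction_on with
    | empty => simpa
    | cons c s ih =>
      rw [Multiset.map_cons, Multiset.prod_cons, mul_smul]
      exact fun h => ih (hroot c _ h)
  rw [(IsAlgClosed.splits p).eq_prod_roots, mul_smul, C_smul_eq] at hp
  rcases smul_eq_zero.mp hp with h | h
  · exact hp0 (leadingCoeff_eq_zero.mp h)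
  · exact key _ h

/-! ### Commutators of coefficients -/

variable (ρ)

lemma mem_of_X_smul_mem {P : Submodule ℂ V} (hP : ∀ v ∈ P, (X : ℂ[X]) • v ∈ P) (p : ℂ[X])
    {v : V} (hv : v ∈ P) : p • v ∈ P := by
  induction p using Polynomial.induction_on' with
  | add p q hp hq => rw [add_smul]; exact P.add_mem hp hq
  | monomial n c =>
    rw [← C_mul_X_pow_eq_monomial, mul_smul, C_smul_eq]
    refine P.smul_mem c ?_
    induction n with
    | zero => simpa
    | succ n ih => rw [pow_succ', mul_smul]; exact hP _ ih

/-- The coefficient of `λ ^ 0` is `ℂ[∂]`-linear. -/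
noncomputable def coefZero (a : R) : V →ₗ[ℂ[X]] V where
  toFun := ρ.coef a 0
  map_add' := map_add _
  map_smul' p v := by
    -- A graph stable under `∂` is stable under `ℂ[∂]`, which is linearity.
    let P : Submodule ℂ (V × V) := LinearMap.graph (ρ.coef a 0)
    have : p • (v, ρ.coef a 0 v) ∈ P := by
      refine mem_of_X_smul_mem (fun w hw => ?_) p (by simp [P])
      simp only [P, LinearMap.mem_graph_iff, Prod.smul_fst, Prod.smul_snd] at hw ⊢
      rw [coef_zero_X_smul, hw]
    simpa [P, eq_comm] using this

lemma coefZero_apply (a : R) (v : V) : ρ.coefZero a v = ρ.coef a 0 v := rfl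

/-- Commutators with the coefficient of `λ ^ 0`. -/
lemma coef_zero_comm (a b : R) (n : ℕ) (v : V) :
    ρ.coef a 0 (ρ.coef b n v) - ρ.coef b n (ρ.coef a 0 v) =
      ρ.coef (evalAt 0 (A.bracket a b)) n v := by
  have h : ∀ f : V →ₗ[ℂ] ℂ, dualPoly (f ∘ₗ ρ.coef a 0) (ρ.act b v) -
      dualPoly f (ρ.act b (ρ.coef a 0 v)) =
      dualPoly f (ρ.act (evalAt 0 (A.bracket a b)) v) := by
    intro f
    refine Polynomial.funext fun y => ?_
    have := congrArg f (ρ.jacobi a b v 0 y)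
    simpa [evalAt_zero_eq, eval_dualPoly, coef_apply] using this
  refine eq_of_dual_eq fun f => ?_
  have := congrArg (fun p => p.coeff n) (h f)
  simpa [coeff_dualPoly, coef_apply] using this

/-- Commutators of coefficients of positive powers of `λ`, when `[a_λ b]_{λ + μ}` acts as
`(s λ + t μ) c_{λ + μ}`. -/
lemma coef_succ_comm (a b c : R) (s t : ℂ)
    (h : ∀ (x y : ℂ) (v : V), evalAt (x + y) (ρ.act (evalAt x (A.bracket a b)) v) =
      (s * x + t * y) • evalAt (x + y) (ρ.act c v)) (j n : ℕ) (v : V) :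
    ρ.coef a (j + 1) (ρ.coef b (n + 1) v) - ρ.coef b (n + 1) (ρ.coef a (j + 1) v) =
      (s * ((n + 1 + j).choose j : ℕ) + t * ((n + (j + 1)).choose (j + 1) : ℕ)) •
        ρ.coef c (n + j + 1) v := by
  refine eq_of_dual_eq fun f => ?_
  set P := dualPoly f (ρ.act c v) with hP
  -- Fix `μ = y` and read the Jacobi identity as polynomials in `λ`; `P(λ + y)` is a Taylor shift,
  -- so its `λ`-coefficients are Hasse derivatives of `P` at `y`.
  have h1 : ∀ y : ℂ, dualPoly f (ρ.act a (evalAt y (ρ.act b v))) -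
      dualPoly (f ∘ₗ (evalAt y).restrictScalars ℂ ∘ₗ ρ.act b) (ρ.act a v) =
      C s * (X * taylor y P) + C (t * y) * taylor y P := by
    intro y
    refine Polynomial.funext fun x => ?_
    have := congrArg f (ρ.jacobi a b v x y)
    rw [h, map_sub, map_smul] at this
    simp only [eval_sub, eval_dualPoly, LinearMap.comp_apply, LinearMap.restrictScalars_apply,
      this, hP, eval_add, eval_mul, eval_C, eval_X, taylor_eval, smul_eq_mul]
    ring
  -- Take the coefficient of `λ ^ (j + 1)`, then let `y` vary; the coefficient of `y ^ (n + 1)`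
  -- gives the binomials.
  have h2 : dualPoly (f ∘ₗ ρ.coef a (j + 1)) (ρ.act b v) -
      dualPoly f (ρ.act b (ρ.coef a (j + 1) v)) =
      C s * hasseDeriv j P + C t * (X * hasseDeriv (j + 1) P) := by
    refine Polynomial.funext fun y => ?_
    have := congrArg (fun p => p.coeff (j + 1)) (h1 y)
    simp only [coeff_sub, coeff_add, coeff_C_mul, coeff_X_mul, taylor_coeff, coeff_dualPoly,
      LinearMap.comp_apply, LinearMap.restrictScalars_apply] at this
    simp only [eval_sub, eval_add, eval_mul, eval_C, eval_X, eval_dualPoly, LinearMap.comp_apply,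
      coef_apply, this]
    ring
  have h3 := congrArg (fun p => p.coeff (n + 1)) h2
  simp only [coeff_sub, coeff_add, coeff_C_mul, coeff_X_mul, hasseDeriv_coeff, coeff_dualPoly,
    LinearMap.comp_apply, hP] at h3
  rw [map_sub, map_smul, smul_eq_mul, coef_apply _ b, coef_apply _ b, h3, coef_apply _ c,
    show n + 1 + j = n + j + 1 by ring, show n + (j + 1) = n + j + 1 by ring]
  ring

end ConformalModule

end Conformal

namespace Conformal

namespace ConformalModule

/-! ### Schur's lemma and finite-dimensionality -/

section General

variable {R : Type*} [AddCommGroup R] [Module ℂ R] [Module ℂ[X] R] [IsScalarTower ℂ ℂ[X] R]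
  {A : LieConformalAlgebra R}
  {V : Type*} [AddCommGroup V] [Module ℂ V] [Module ℂ[X] V] [IsScalarTower ℂ ℂ[X] V]
  {ρ : ConformalModule A V}

/-- An endomorphism of a nonzero free `ℂ[∂]`-module of finite rank becomes non-surjective after
subtracting a suitable complex number, namely an eigenvalue modulo `∂`. -/
lemma exists_sub_smul_range_ne_top [Module.Finite ℂ[X] V] [Module.Free ℂ[X] V] [Nontrivial V]
    (T : V →ₗ[ℂ[X]] V) :
    ∃ c : ℂ, LinearMap.range (T - (C c : ℂ[X]) • LinearMap.id) ≠ ⊤ := by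
  let b := Module.Free.chooseBasis ℂ[X] V
  have : Nonempty (Module.Free.ChooseBasisIndex ℂ[X] V) := b.index_nonempty
  let B := (evalRingHom (0 : ℂ)).mapMatrix (LinearMap.toMatrix b b T)
  obtain ⟨c, hc⟩ := Module.End.exists_eigenvalue (Matrix.toLin' B)
  obtain ⟨w, hw⟩ := hc.exists_hasEigenvector
  refine ⟨c, fun htop => ?_⟩
  have hdet : (B - c • (1 : Matrix _ _ ℂ)).det = 0 := by
    refine Matrix.exists_mulVec_eq_zero_iff.mp ⟨w, hw.2, ?_⟩
    have := hw.apply_eq_smul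
    rw [Matrix.toLin'_apply] at this
    rw [Matrix.sub_mulVec, this, Matrix.smul_mulVec, Matrix.one_mulVec, sub_self]
  -- A surjective endomorphism of a finite module is bijective, so its determinant is a unit; but
  -- this determinant vanishes at `∂ = 0`.
  have hunit : IsUnit (T - (C c : ℂ[X]) • LinearMap.id) := by
    rw [Module.End.isUnit_iff]
    exact OrzechProperty.bijective_of_surjective_endomorphism _ (LinearMap.range_eq_top.mp htop)
  have h := (LinearMap.isUnit_det _ hunit).map (evalRingHom (0 : ℂ))
  rw [← LinearMap.det_toMatrix b, RingHom.map_det] at h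
  have hmat : (evalRingHom (0 : ℂ)).mapMatrix
      (LinearMap.toMatrix b b (T - (C c : ℂ[X]) • LinearMap.id)) = B - c • 1 := by
    rw [map_sub, map_sub, map_smul, LinearMap.toMatrix_id]
    congr 1
    ext i j
    by_cases hij : i = j <;> simp [hij]
  rw [hmat, hdet] at h
  exact not_isUnit_zero h

/-- Schur's lemma for finite irreducible conformal modules. -/
theorem IsIrreducible.exists_eq_smul_of_comm (hirr : ρ.IsIrreducible) [Module.Finite ℂ[X] V]
    [Module.IsTorsionFree ℂ[X] V] (T : V →ₗ[ℂ[X]] V)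
    (hT : ∀ (a : R) (n : ℕ) (v : V), T (ρ.coef a n v) = ρ.coef a n (T v)) :
    ∃ c : ℂ, ∀ v, T v = c • v := by
  have := hirr.1
  obtain ⟨c, hc⟩ := exists_sub_smul_range_ne_top T
  refine ⟨c, ?_⟩
  have hinv : ρ.IsInvariant (LinearMap.range (T - (C c : ℂ[X]) • LinearMap.id)) := by
    rintro a _ ⟨v, rfl⟩ n
    refine ⟨ρ.coef a n v, ?_⟩
    rw [← coef_apply]
    simp [hT, C_smul_eq]
  have h0 := (hirr.2 _ hinv).resolve_right hc
  rw [LinearMap.range_eq_bot] at h0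
  intro v
  have := LinearMap.congr_fun h0 v
  simpa [sub_eq_zero, C_smul_eq] using this

/-- Bounding the degree in `λ` of `a_λ v` cuts out a finite-dimensional space of vectors `v`,
provided `a_λ` is injective. -/
lemma finiteDimensional_of_coef_eq_zero [Module.Finite ℂ[X] V] [Module.Free ℂ[X] V] (a : R)
    (ha : ∀ v, (∀ k, ρ.coef a k v = 0) → v = 0) (m : ℕ) (F : Submodule ℂ V)
    (hF : ∀ v ∈ F, ∀ k, m ≤ k → ρ.coef a k v = 0) : FiniteDimensional ℂ F := by
  let b := Module.Free.chooseBasis ℂ[X] V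
  -- `T` is reduction modulo `∂ ^ m`. It is injective on `F`: if `v = ∂ ^ m u`, then `a_λ v = (∂ +
  -- λ) ^ m a_λ u` has degree below `m` only when `a_λ u = 0`.
  let T : V →ₗ[ℂ] (Module.Free.ChooseBasisIndex ℂ[X] V → Fin m → ℂ) :=
    LinearMap.pi fun i => LinearMap.pi fun j =>
      (lcoeff ℂ j) ∘ₗ ((b.coord i).restrictScalars ℂ)
  refine Module.Finite.of_injective (T ∘ₗ F.subtype) ?_
  rw [injective_iff_map_eq_zero]
  intro v hv
  have hdvd : ∀ i, (X : ℂ[X]) ^ m ∣ b.coord i v := by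
    intro i
    rw [X_pow_dvd_iff]
    intro d hd
    exact congrFun (congrFun hv i) ⟨d, hd⟩
  choose q hq using hdvd
  have hvq : (v : V) = (X : ℂ[X]) ^ m • b.equivFun.symm q := by
    rw [← map_smul, LinearEquiv.eq_symm_apply]
    funext i
    exact hq i
  have h0 : b.equivFun.symm q = 0 :=
    ha _ (ρ.coef_eq_zero_of_X_pow_smul a _ m (hvq ▸ hF v v.2))
  rw [h0, smul_zero] at hvq
  exact Subtype.ext hvq

variable (ρ)

/-- It suffices to check invariance of a cyclic submodule on its generator. -/
lemma coef_mem_span (a : R) (w : V) (h : ∀ n, ρ.coef a n w ∈ Submodule.span ℂ[X] {w}) (v : V)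
    (hv : v ∈ Submodule.span ℂ[X] {w}) (n : ℕ) : ρ.coef a n v ∈ Submodule.span ℂ[X] {w} := by
  set U := Submodule.span ℂ[X] {w}
  let P : Submodule ℂ V := ⨅ n, (U.restrictScalars ℂ).comap (ρ.coef a n)
  have hP : ∀ v, v ∈ P ↔ ∀ n, ρ.coef a n v ∈ U := by simp [P]
  obtain ⟨p, rfl⟩ := Submodule.mem_span_singleton.mp hv
  refine (hP _).mp (mem_of_X_smul_mem (fun v hv => ?_) p ((hP w).mpr h)) n
  rw [hP] at hv ⊢
  rintro (_ | n)
  · rw [coef_zero_X_smul]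
    exact U.smul_mem _ (hv 0)
  · rw [coef_succ_X_smul]
    exact U.add_mem (U.smul_mem _ (hv _)) (hv n)

end General

/-! ### The commutation relations of the generators -/

/-- The generators, as elements of the algebra. -/
noncomputable def gen (g : Gen) : SV := Pi.single g 1

lemma eq_sum_gen (a : SV) : a = ∑ g, a g • gen g := by
  simp [gen, ← Pi.single_smul, Finset.univ_sum_single]

lemma mem_of_gen_mem {P : Submodule ℂ SV} (hX : ∀ a ∈ P, (X : ℂ[X]) • a ∈ P)
    (hg : ∀ g, gen g ∈ P) (a : SV) : a ∈ P := by
  rw [eq_sum_gen a]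
  exact P.sum_mem fun g _ => mem_of_X_smul_mem hX _ (hg g)

lemma evalAt_zero_bracket_L (a : SV) :
    evalAt 0 (svTilde.bracket (gen .L) a) = (X : ℂ[X]) • a := by
  simp only [svTilde, evalAt]
  ext1 k
  cases k <;>
    simp [subst_svBracket_L, subst_svBracket_M, subst_svBracket_Y, subst_svBracket_N, gen] <;>
    ring

/-- The eigenvalues of `N_0` on the generators. -/
def charge : Gen → ℕ
  | .L => 0
  | .N => 0
  | .Y => 1
  | .M => 2

lemma evalAt_zero_bracket_N (g : Gen) :
    evalAt 0 (svTilde.bracket (gen .N) (gen g)) = (charge g : ℂ) • gen g := by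
  simp only [svTilde, evalAt]
  ext1 k
  cases k <;> cases g <;>
    simp [subst_svBracket_L, subst_svBracket_M, subst_svBracket_Y, subst_svBracket_N, gen,
      charge, smul_eq_C_mul]

lemma evalAt_bracket_L_L (x : ℂ) :
    evalAt x (svTilde.bracket (gen .L) (gen .L)) = (X : ℂ[X]) • gen .L + (2 * x) • gen .L := by
  simp only [svTilde, evalAt]
  ext1 k
  cases k <;>
    simp [subst_svBracket_L, subst_svBracket_M, subst_svBracket_Y, subst_svBracket_N, gen,
      smul_eq_C_mul]

lemma evalAt_bracket_L_N (x : ℂ) :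
    evalAt x (svTilde.bracket (gen .L) (gen .N)) = (X : ℂ[X]) • gen .N + x • gen .N := by
  simp only [svTilde, evalAt]
  ext1 k
  cases k <;>
    simp [subst_svBracket_L, subst_svBracket_M, subst_svBracket_Y, subst_svBracket_N, gen,
      smul_eq_C_mul]

lemma evalAt_bracket_N_N (x : ℂ) :
    evalAt x (svTilde.bracket (gen .N) (gen .N)) = 0 := by
  simp only [svTilde, evalAt]
  ext1 k
  cases k <;>
    simp [subst_svBracket_L, subst_svBracket_M, subst_svBracket_Y, subst_svBracket_N, gen]

variable {V : Type*} [AddCommGroup V] [Module ℂ V] [Module ℂ[X] V] [IsScalarTower ℂ ℂ[X] V]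
  (ρ : ConformalModule svTilde V)

lemma coef_L_L (j n : ℕ) (v : V) :
    ρ.coef (gen .L) (j + 1) (ρ.coef (gen .L) (n + 1) v) -
      ρ.coef (gen .L) (n + 1) (ρ.coef (gen .L) (j + 1) v) =
      (1 * ((n + 1 + j).choose j : ℕ) + (-1) * ((n + (j + 1)).choose (j + 1) : ℕ) : ℂ) •
        ρ.coef (gen .L) (n + j + 1) v := by
  -- In `[L_λ L]_{λ+μ}`, `∂` acts as `-(λ + μ)`, so `∂ + 2λ` becomes `λ - μ`.
  refine ρ.coef_succ_comm _ _ _ 1 (-1) (fun x y v => ?_) j n v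
  rw [evalAt_bracket_L_L, map_add, LinearMap.add_apply, map_add, ρ.act_D_left, map_smul,
    LinearMap.smul_apply, evalAt_smul]
  module

lemma coef_L_N (j n : ℕ) (v : V) :
    ρ.coef (gen .L) (j + 1) (ρ.coef (gen .N) (n + 1) v) -
      ρ.coef (gen .N) (n + 1) (ρ.coef (gen .L) (j + 1) v) =
      (0 * ((n + 1 + j).choose j : ℕ) + (-1) * ((n + (j + 1)).choose (j + 1) : ℕ) : ℂ) •
        ρ.coef (gen .N) (n + j + 1) v := by
  refine ρ.coef_succ_comm _ _ _ 0 (-1) (fun x y v => ?_) j n v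
  rw [evalAt_bracket_L_N, map_add, LinearMap.add_apply, map_add, ρ.act_D_left, map_smul,
    LinearMap.smul_apply, evalAt_smul]
  module

lemma coef_N_N (j n : ℕ) (v : V) :
    ρ.coef (gen .N) (j + 1) (ρ.coef (gen .N) (n + 1) v) =
      ρ.coef (gen .N) (n + 1) (ρ.coef (gen .N) (j + 1) v) := by
  rw [← sub_eq_zero, ρ.coef_succ_comm _ _ 0 0 0 (fun x y v => ?_) j n v]
  · simp
  · simp [evalAt_bracket_N_N]

lemma coef_N_zero (g : Gen) (n : ℕ) (v : V) :
    ρ.coef (gen .N) 0 (ρ.coef (gen g) n v) =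
      ρ.coef (gen g) n (ρ.coef (gen .N) 0 v) + (charge g : ℂ) • ρ.coef (gen g) n v := by
  rw [← sub_eq_iff_eq_add', coef_zero_comm, evalAt_zero_bracket_N, coef_smul_left]

lemma isInvariant_of_gen (U : Submodule ℂ[X] V)
    (h : ∀ g, ∀ v ∈ U, ∀ n, ρ.coef (gen g) n v ∈ U) : ρ.IsInvariant U := by
  let P : Submodule ℂ SV :=
    { carrier := {a | ∀ v ∈ U, ∀ n, ρ.coef a n v ∈ U}
      add_mem' := fun ha hb v hv n => by
        rw [coef_add_left]
        exact U.add_mem (ha v hv n) (hb v hv n)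
      zero_mem' := fun v _ n => by simp [coef_apply]
      smul_mem' := fun c a ha v hv n => by
        rw [coef_smul_left, ← C_smul_eq]
        exact U.smul_mem _ (ha v hv n) }
  refine fun a => mem_of_gen_mem (P := P) (fun a ha v hv n => ?_) h a
  cases n with
  | zero => rw [coef_X_smul_left_zero]; exact U.zero_mem
  | succ n => rw [coef_X_smul_left_succ]; exact U.neg_mem (ha v hv n)

variable {ρ}

/-- Commutation with `L_0` sends `a_n` to `(∂a)_n`, and so does commutation with `∂`. Schur's lemma
applies to the difference. -/
lemma exists_coef_L_zero (hirr : ρ.IsIrreducible) [Module.Finite ℂ[X] V]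
    [Module.IsTorsionFree ℂ[X] V] :
    ∃ α : ℂ, ∀ v, ρ.coef (gen .L) 0 v = (X + C α : ℂ[X]) • v := by
  obtain ⟨c, hc⟩ := hirr.exists_eq_smul_of_comm
    (ρ.coefZero (gen .L) - (X : ℂ[X]) • LinearMap.id) (fun a n v => by
      have h := ρ.coef_zero_comm (gen .L) a n v
      rw [evalAt_zero_bracket_L, sub_eq_iff_eq_add] at h
      simp only [LinearMap.sub_apply, LinearMap.smul_apply, LinearMap.id_apply, coefZero_apply,
        map_sub, h]
      cases n with
      | zero => rw [coef_X_smul_left_zero, coef_zero_X_smul]; abel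
      | succ n => rw [coef_X_smul_left_succ, coef_succ_X_smul]; abel)
  refine ⟨c, fun v => ?_⟩
  have := hc v
  simp only [LinearMap.sub_apply, LinearMap.smul_apply, LinearMap.id_apply, coefZero_apply,
    sub_eq_iff_eq_add] at this
  rw [this, add_smul, C_smul_eq, add_comm]

/-! ### Vectors of bounded degree -/

variable (ρ)

/-- The vectors on which `L_λ` and `N_λ` have degree less than `m`. -/
noncomputable def bounded (m : ℕ) : Submodule ℂ V :=
  ⨅ k : {k // m ≤ k}, LinearMap.ker (ρ.coef (gen .L) k) ⊓ LinearMap.ker (ρ.coef (gen .N) k)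

lemma mem_bounded {m : ℕ} {v : V} : v ∈ ρ.bounded m ↔
    ∀ k, m ≤ k → ρ.coef (gen .L) k v = 0 ∧ ρ.coef (gen .N) k v = 0 := by
  simp [bounded]

lemma exists_bounded_ne_bot [Nontrivial V] : ∃ m, ρ.bounded (m + 1) ≠ ⊥ := by
  obtain ⟨v, hv⟩ := exists_ne (0 : V)
  obtain ⟨m, hm⟩ := ρ.exists_coef_eq_zero (gen .L) v
  obtain ⟨n, hn⟩ := ρ.exists_coef_eq_zero (gen .N) v
  refine ⟨m + n, (Submodule.ne_bot_iff _).mpr ⟨v, ρ.mem_bounded.mpr fun k hk => ?_, hv⟩⟩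
  exact ⟨hm k (by omega), hn k (by omega)⟩

lemma coef_N_zero_mem_bounded {m : ℕ} {v : V} (hv : v ∈ ρ.bounded m) :
    ρ.coef (gen .N) 0 v ∈ ρ.bounded m := by
  rw [mem_bounded] at hv ⊢
  intro k hk
  have h1 := ρ.coef_N_zero .L k v
  have h2 := ρ.coef_N_zero .N k v
  rw [(hv k hk).1] at h1
  rw [(hv k hk).2] at h2
  constructor
  · simpa using h1.symm
  · simpa using h2.symm

/-- The commutator of two coefficients of positive index `i`, `j` is a multiple of one of index `i +
j - 1`, at least `max i j`. The bound `m + 1` keeps index 0 out. -/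
lemma coef_L_succ_mem_bounded {m : ℕ} {v : V} (hv : v ∈ ρ.bounded (m + 1)) (n : ℕ) :
    ρ.coef (gen .L) (n + 1) v ∈ ρ.bounded (m + 1) := by
  rw [mem_bounded] at hv ⊢
  rintro (_ | k) hk
  · omega
  have h1 := ρ.coef_L_L k n v
  have h2 := ρ.coef_L_N n k v
  rw [(hv (k + 1) hk).1, (hv (n + k + 1) (by omega)).1, map_zero, smul_zero, sub_zero] at h1
  rw [(hv (k + 1) hk).2, (hv (k + n + 1) (by omega)).2, map_zero, smul_zero, zero_sub,
    neg_eq_zero] at h2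
  exact ⟨h1, h2⟩

lemma coef_N_succ_mem_bounded {m : ℕ} {v : V} (hv : v ∈ ρ.bounded (m + 1)) (n : ℕ) :
    ρ.coef (gen .N) (n + 1) v ∈ ρ.bounded (m + 1) := by
  rw [mem_bounded] at hv ⊢
  rintro (_ | k) hk
  · omega
  have h1 := ρ.coef_L_N k n v
  rw [(hv (k + 1) hk).1, (hv (n + k + 1) (by omega)).2, map_zero, smul_zero, sub_zero] at h1
  exact ⟨h1, by rw [coef_N_N, (hv (k + 1) hk).2, map_zero]⟩

lemma finiteDimensional_bounded [Module.Finite ℂ[X] V] [Module.IsTorsionFree ℂ[X] V] {α : ℂ}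
    (hα : ∀ v, ρ.coef (gen .L) 0 v = (X + C α : ℂ[X]) • v) (m : ℕ) :
    FiniteDimensional ℂ (ρ.bounded m) := by
  refine finiteDimensional_of_coef_eq_zero (gen .L) (fun v hv => ?_) m _
    fun v hv k hk => (ρ.mem_bounded.mp hv k hk).1
  have := hv 0
  rw [hα] at this
  exact (smul_eq_zero.mp this).resolve_left (X_add_C_ne_zero α)

/-! ### Eigenvectors of `N_0` and `L_1` -/

variable {ρ}

/-- `V` is infinite-dimensional over `ℂ`, so the eigenvector is sought in a nonzero
finite-dimensional `N_0`-stable space of bounded vectors. -/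
lemma exists_coef_N_zero (hirr : ρ.IsIrreducible) [Module.Finite ℂ[X] V]
    [Module.IsTorsionFree ℂ[X] V] {α : ℂ}
    (hα : ∀ v, ρ.coef (gen .L) 0 v = (X + C α : ℂ[X]) • v) :
    ∃ (β : ℂ) (w : V), w ≠ 0 ∧ ρ.coef (gen .N) 0 w = β • w := by
  have := hirr.1
  obtain ⟨m, hm⟩ := ρ.exists_bounded_ne_bot
  have := ρ.finiteDimensional_bounded hα (m + 1)
  have : Nontrivial (ρ.bounded (m + 1)) := Submodule.nontrivial_iff_ne_bot.mpr hm
  obtain ⟨β, hβ⟩ := Module.End.exists_eigenvalue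
    ((ρ.coef (gen .N) 0).restrict fun v hv => ρ.coef_N_zero_mem_bounded (m := m + 1) hv)
  obtain ⟨w, hw⟩ := hβ.exists_hasEigenvector
  exact ⟨β, w, by simpa using hw.2, by simpa using congrArg Subtype.val hw.apply_eq_smul⟩

/-- `N_0` acts as a scalar, and `M` and `Y` act by zero. -/
theorem coef_N_zero_and_charged (hirr : ρ.IsIrreducible) [Module.IsTorsionFree ℂ[X] V]
    {β : ℂ} {w : V} (hw : w ≠ 0) (hβ : ρ.coef (gen .N) 0 w = β • w) :
    (∀ v, ρ.coef (gen .N) 0 v = β • v) ∧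
      ∀ g, 0 < charge g → ∀ n v, ρ.coef (gen g) n v = 0 := by
  let E : ℕ → Submodule ℂ[X] V := fun k =>
    Module.End.eigenspace (ρ.coefZero (gen .N)) (C (β + k))
  have hE : ∀ k v, v ∈ E k ↔ ρ.coef (gen .N) 0 v = (β + k) • v := by
    intro k v
    rw [Module.End.mem_eigenspace_iff, coefZero_apply, C_smul_eq]
  have hstep : ∀ g k v n, v ∈ E k → ρ.coef (gen g) n v ∈ E (k + charge g) := by
    intro g k v n hv
    rw [hE] at hv ⊢
    rw [coef_N_zero, hv, map_smul, ← add_smul]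
    push_cast
    ring_nf
  -- Charges are nonnegative, so `U` is invariant; it misses `w` because eigenspaces for distinct
  -- eigenvalues are independent.
  let U : Submodule ℂ[X] V := ⨆ k : ℕ, E (k + 1)
  have hU : ρ.IsInvariant U := by
    refine ρ.isInvariant_of_gen U fun g v hv n => ?_
    refine Submodule.iSup_induction _ (motive := fun v => ρ.coef (gen g) n v ∈ U) hv
      (fun k v hv => ?_) (by simp) (fun v w hv hw => by rw [map_add]; exact U.add_mem hv hw)
    have := hstep g _ _ n hv
    rw [add_right_comm] at this
    exact Submodule.mem_iSup_of_mem (k + charge g) this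
  have hwE : w ∈ E 0 := by simpa [hE] using hβ
  have hU0 : U = ⊥ := by
    refine (hirr.2 U hU).resolve_right fun htop => hw ?_
    have hind := Module.End.eigenspaces_iSupIndep (ρ.coefZero (gen .N)) (C (β + (0 : ℕ)))
    refine Submodule.disjoint_def.mp hind w hwE ?_
    have hle : U ≤ ⨆ j, ⨆ (_ : j ≠ C (β + (0 : ℕ))), Module.End.eigenspace (ρ.coefZero (gen .N)) j := by
      refine iSup_le fun k => le_iSup₂_of_le (C (β + ((k + 1 : ℕ) : ℂ))) ?_ le_rfl
      intro h
      have h' : ((k + 1 : ℕ) : ℂ) = ((0 : ℕ) : ℂ) := add_left_cancel (C_injective h)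
      exact absurd (Nat.cast_injective h') (by omega)
    exact hle (htop ▸ Submodule.mem_top)
  have hpos : ∀ k v, v ∈ E (k + 1) → v = 0 := by
    intro k v hv
    have : v ∈ U := Submodule.mem_iSup_of_mem k hv
    rwa [hU0, Submodule.mem_bot] at this
  have hcharged : ∀ g, 0 < charge g → ∀ n, ∀ v ∈ E 0, ρ.coef (gen g) n v = 0 := by
    intro g hg n v hv
    refine hpos (charge g - 1) _ ?_
    have := hstep g _ _ n hv
    rwa [show 0 + charge g = charge g - 1 + 1 by omega] at this
  have hE0 : ρ.IsInvariant (E 0) := by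
    refine ρ.isInvariant_of_gen _ fun g v hv n => ?_
    rcases Nat.eq_zero_or_pos (charge g) with hg | hg
    · simpa [hg] using hstep g 0 v n hv
    · rw [hcharged g hg n v hv]
      exact Submodule.zero_mem _
  have htop : E 0 = ⊤ := (hirr.2 _ hE0).resolve_left fun h => hw (by simpa [h] using hwE)
  have hmem : ∀ v, v ∈ E 0 := fun v => htop ▸ Submodule.mem_top
  exact ⟨fun v => by simpa using (hE 0 v).mp (hmem v), fun g hg n v => hcharged g hg n v (hmem v)⟩

/-- There is an eigenvector of `L_1` that is killed by all higher coefficients of `L` and `N`. -/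
theorem exists_highest_weight_vector [Nontrivial V] [Module.Finite ℂ[X] V]
    [Module.IsTorsionFree ℂ[X] V] {α : ℂ}
    (hα : ∀ v, ρ.coef (gen .L) 0 v = (X + C α : ℂ[X]) • v) :
    ∃ (Δ : ℂ) (w : V), w ≠ 0 ∧ ρ.coef (gen .L) 1 w = Δ • w ∧
      (∀ n, ρ.coef (gen .L) (n + 2) w = 0) ∧ ∀ n, ρ.coef (gen .N) (n + 1) w = 0 := by
  obtain ⟨m, hm⟩ := ρ.exists_bounded_ne_bot
  have := ρ.finiteDimensional_bounded hα (m + 1)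
  have : Nontrivial (ρ.bounded (m + 1)) := Submodule.nontrivial_iff_ne_bot.mpr hm
  -- `S` has finitely many eigenvalues, so one of least real part exists, and `Δ - (k + 1)` is then
  -- never an eigenvalue.
  let S : Module.End ℂ (ρ.bounded (m + 1)) :=
    (ρ.coef (gen .L) 1).restrict fun v hv => ρ.coef_L_succ_mem_bounded hv 0
  obtain ⟨Δ, hΔ, hmin⟩ := Set.exists_min_image {c | S.HasEigenvalue c} Complex.re
    S.finite_hasEigenvalue (Module.End.exists_eigenvalue S)
  obtain ⟨w, hw⟩ := hΔ.exists_hasEigenvector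
  have hSw : ρ.coef (gen .L) 1 w = Δ • (w : V) := congrArg Subtype.val hw.apply_eq_smul
  have hlow : ∀ (u : V) (k : ℕ), u ∈ ρ.bounded (m + 1) →
      ρ.coef (gen .L) 1 u = (Δ - ((k + 1 : ℕ) : ℂ)) • u → u = 0 := by
    intro u k hu h
    by_contra hne
    have hev : S.HasEigenvalue (Δ - ((k + 1 : ℕ) : ℂ)) :=
      Module.End.hasEigenvalue_of_hasEigenvector (x := ⟨u, hu⟩)
        ⟨Module.End.mem_eigenspace_iff.mpr (Subtype.ext h), fun h0 => hne (congrArg Subtype.val h0)⟩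
    have := hmin _ hev
    rw [Complex.sub_re, Complex.natCast_re] at this
    push_cast at this
    have hk : (0 : ℝ) ≤ k := Nat.cast_nonneg k
    linarith
  refine ⟨Δ, w, by simpa using hw.2, hSw, fun n => ?_, fun n => ?_⟩
  · refine hlow _ n (ρ.coef_L_succ_mem_bounded w.2 (n + 1)) ?_
    have h := ρ.coef_L_L 0 (n + 1) w
    rw [sub_eq_iff_eq_add] at h
    simp only [zero_add, add_zero, Nat.choose_zero_right, Nat.choose_one_right] at h
    rw [h, hSw, map_smul, ← add_smul]
    push_cast
    ring_nf
  · refine hlow _ n (ρ.coef_N_succ_mem_bounded w.2 n) ?_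
    have h := ρ.coef_L_N 0 n w
    rw [sub_eq_iff_eq_add] at h
    simp only [zero_add, add_zero, Nat.choose_zero_right, Nat.choose_one_right] at h
    rw [h, hSw, map_smul, ← add_smul]
    push_cast
    ring_nf

end ConformalModule

end Conformal

namespace Conformal

/-! ### Weight vectors and rank one modules -/

namespace ConformalModule

lemma rankOne_act_gen (α β Δ : ℂ) (g : Gen) :
    (rankOne α β Δ).act (gen g) 1 = genAct α β Δ g :=
  eq_of_evalAt_eq fun x => by
    have h : (rankOne α β Δ).act = rankOneAct α β Δ := rfl
    rw [h, evalAt, subst_rankOneAct_eq]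
    cases g <;> simp [gen, genAct, subst_single, mul_comm]

variable {V : Type*} [AddCommGroup V] [Module ℂ V] [Module ℂ[X] V] [IsScalarTower ℂ ℂ[X] V]
  {W : Type*} [AddCommGroup W] [Module ℂ W] [Module ℂ[X] W] [IsScalarTower ℂ ℂ[X] W]
  {ρ : ConformalModule svTilde V}

/-- A `ℂ[∂]`-linear isomorphism from a cyclic module intertwines the actions as soon as it does so
for the generators of the algebra on the cyclic vector. -/
lemma coef_equiv_of_gen {σ : ConformalModule svTilde W} (φ : V ≃ₗ[ℂ[X]] W) {w : V}
    (hw : Submodule.span ℂ[X] {w} = ⊤)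
    (h : ∀ g n, σ.coef (gen g) n (φ w) = φ (ρ.coef (gen g) n w)) (a : SV) (v : V) (n : ℕ) :
    σ.coef a n (φ v) = φ (ρ.coef a n v) := by
  have hφ : ∀ (c : ℂ) (v : V), φ (c • v) = c • φ v := fun c v => by
    rw [← C_smul_eq, map_smul, C_smul_eq]
  have hgen : ∀ g v n, σ.coef (gen g) n (φ v) = φ (ρ.coef (gen g) n v) := by
    intro g v
    let P : Submodule ℂ V :=
      { carrier := {v | ∀ n, σ.coef (gen g) n (φ v) = φ (ρ.coef (gen g) n v)}
        add_mem' := fun ha hb n => by simp only [map_add, ha n, hb n]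
        zero_mem' := fun n => by simp
        smul_mem' := fun c v hv n => by rw [hφ, map_smul, map_smul, hφ, hv n] }
    obtain ⟨p, rfl⟩ := Submodule.mem_span_singleton.mp (hw ▸ Submodule.mem_top : v ∈ _)
    refine mem_of_X_smul_mem (P := P) (fun v hv n => ?_) p (h g)
    cases n with
    | zero => rw [map_smul, coef_zero_X_smul, coef_zero_X_smul, map_smul, hv 0]
    | succ n =>
      rw [map_smul, coef_succ_X_smul, coef_succ_X_smul, map_add, map_smul, hv n, hv (n + 1)]
  let P : Submodule ℂ SV :=
    { carrier := {a | ∀ v n, σ.coef a n (φ v) = φ (ρ.coef a n v)}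
      add_mem' := fun ha hb v n => by simp only [coef_add_left, map_add, ha v n, hb v n]
      zero_mem' := fun v n => by simp [coef_apply]
      smul_mem' := fun c a ha v n => by rw [coef_smul_left, coef_smul_left, hφ, ha v n] }
  refine mem_of_gen_mem (P := P) (fun a ha v n => ?_) hgen a v n
  cases n with
  | zero => rw [coef_X_smul_left_zero, coef_X_smul_left_zero, map_zero]
  | succ n => rw [coef_X_smul_left_succ, coef_X_smul_left_succ, map_neg, ha v n]

/-- `L_λ w = (∂ + α + Δ λ) w`, `N_λ w = β w` and `M_λ w = Y_λ w = 0`. -/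
def IsWeightVector (ρ : ConformalModule svTilde V) (α β Δ : ℂ) (w : V) : Prop :=
  ∀ g n, ρ.coef (gen g) n w = genAct α β Δ g n • w

lemma IsWeightVector.isInvariant_span {α β Δ : ℂ} {w : V} (hw : ρ.IsWeightVector α β Δ w) :
    ρ.IsInvariant (Submodule.span ℂ[X] {w}) := by
  refine ρ.isInvariant_of_gen _ fun g => ρ.coef_mem_span (gen g) w fun n => ?_
  rw [hw]
  exact Submodule.smul_mem _ _ (Submodule.mem_span_singleton_self w)

lemma IsWeightVector.iso {α β Δ : ℂ} {w : V} [Module.IsTorsionFree ℂ[X] V] (hw0 : w ≠ 0)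
    (hspan : Submodule.span ℂ[X] {w} = ⊤) (hw : ρ.IsWeightVector α β Δ w) :
    ρ.Iso (rankOne α β Δ) := by
  let ψ : ℂ[X] ≃ₗ[ℂ[X]] V := LinearEquiv.ofBijective (LinearMap.toSpanSingleton ℂ[X] V w)
    ⟨(injective_iff_map_eq_zero _).mpr fun p hp => (smul_eq_zero.mp hp).resolve_right hw0,
      LinearMap.range_eq_top.mp (by rw [LinearMap.range_toSpanSingleton, hspan])⟩
  have hψ : ∀ p, ψ p = p • w := fun p => rfl
  have hφ : ∀ p : ℂ[X], ψ.symm (p • w) = p := fun p => by rw [← hψ, ψ.symm_apply_apply]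
  refine ⟨ψ.symm, coef_equiv_of_gen (ρ := ρ) (σ := rankOne α β Δ) ψ.symm hspan
    fun g n => ?_⟩
  rw [hw, hφ, show ψ.symm w = 1 by simpa using hφ 1, coef_apply, rankOne_act_gen]

/-- For `Δ = β = 0` the vector `(∂ + α) w` generates a proper submodule. -/
lemma IsWeightVector.X_add_C_smul {α : ℂ} {w : V} (hw : ρ.IsWeightVector α 0 0 w) :
    ρ.IsWeightVector α 0 1 ((X + C α : ℂ[X]) • w) := by
  intro g n
  have hC : ∀ n, ρ.coef (gen g) n ((C α : ℂ[X]) • w) = (C α : ℂ[X]) • ρ.coef (gen g) n w := by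
    intro n
    rw [C_smul_eq, map_smul, C_smul_eq]
  rw [add_smul, map_add, hC]
  rcases n with _ | n
  · rw [coef_zero_X_smul, hw]
    cases g <;> simp [genAct, ← add_smul, ← mul_smul]; ring_nf
  · rw [coef_succ_X_smul, hw, hw]
    rcases n with _ | n <;> cases g <;> simp [genAct, ← add_smul]

lemma IsIrreducible.weight_ne_zero (hirr : ρ.IsIrreducible) {α β Δ : ℂ} {w : V}
    [Module.IsTorsionFree ℂ[X] V] (hw0 : w ≠ 0) (hw : ρ.IsWeightVector α β Δ w) :
    (Δ, β) ≠ (0, 0) := by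
  intro h
  obtain ⟨rfl, rfl⟩ := Prod.mk.injEq _ _ _ _ ▸ h
  rcases hirr.2 _ hw.X_add_C_smul.isInvariant_span with h | h
  · rw [Submodule.span_singleton_eq_bot] at h
    exact hw0 ((smul_eq_zero.mp h).resolve_left (X_add_C_ne_zero α))
  -- If `w = p(∂)(∂ + α)w`, torsion-freeness would make `∂ + α` a unit of `ℂ[∂]`.
  · obtain ⟨p, hp⟩ := Submodule.mem_span_singleton.mp (h ▸ Submodule.mem_top : w ∈ _)
    rw [← mul_smul, ← sub_eq_zero, ← one_smul ℂ[X] w, ← mul_smul, ← sub_smul, mul_one,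
      smul_eq_zero, or_iff_left hw0, sub_eq_zero] at hp
    exact not_isUnit_X_add_C α (IsUnit.of_mul_eq_one_right p hp)

end ConformalModule

end Conformal

/-! ### The classification -/

open Conformal ConformalModule

theorem mainTheorem1 {V : Type*} [AddCommGroup V] [Module ℂ V] [Module (Polynomial ℂ) V]
    [IsScalarTower ℂ (Polynomial ℂ) V]
    (ρ : Conformal.ConformalModule Conformal.svTilde V)
    (hfin : Module.Finite (Polynomial ℂ) V)
    (hnontriv : ¬ ρ.IsTrivial)
    (hirr : ρ.IsIrreducible) :
    ∃ α β Δ : ℂ, (Δ, β) ≠ (0, 0) ∧ ρ.Iso (Conformal.rankOne α β Δ) := by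
  have := hirr.1
  have := hirr.isTorsionFree hnontriv
  obtain ⟨α, hα⟩ := exists_coef_L_zero hirr
  obtain ⟨β, u, hu, hβu⟩ := exists_coef_N_zero hirr hα
  obtain ⟨hβ, hcharged⟩ := coef_N_zero_and_charged hirr hu hβu
  -- `w` need not be related to `u`: by now `N_0` is the scalar `β` on all of `V`.
  obtain ⟨Δ, w, hw0, hL1, hL, hN⟩ := exists_highest_weight_vector hα
  have hw : ρ.IsWeightVector α β Δ w := by
    rintro (_ | _ | _ | _) n
    · rcases n with _ | _ | n
      · simp [hα, genAct]
      · simp [hL1, genAct, C_smul_eq]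
      · simp [hL, genAct]
    · rw [hcharged _ (by decide)]
      simp [genAct]
    · rw [hcharged _ (by decide)]
      simp [genAct]
    · rcases n with _ | n
      · simp [hβ, genAct, C_smul_eq]
      · simp [hN, genAct]
  have hspan : Submodule.span ℂ[X] {w} = ⊤ := (hirr.2 _ hw.isInvariant_span).resolve_left
    fun h => hw0 (Submodule.span_singleton_eq_bot.mp h)
  exact ⟨α, β, Δ, hirr.weight_ne_zero hw0 hw, hw.iso hw0 hspan⟩
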